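/- Let $\mathbb{F}_q$ be the finite field with $q$ elements and let $k\ge 1$. An \emph{arc} in $\mathbb{F}_q^k$ is an ordered family of at least $k$ vectors in which every subfamily of size $k$ is a basis of $\mathbb{F}_q^k$. Two arcs are \emph{linearly equivalent} if the matrix whose columns are the vectors of the first can be transformed into the matrix whose columns are the vectors of the second by elementary row operations, permutations of the columns, and multiplication of columns by nonzero scalars. The \emph{normal rational curve} is $$\mathcal{R}_k=\{(1,t,t^2,\dots,t^{k-1}) : t\in\mathbb{F}_q\}\cup\{(0,\dots,0,1)\},$$ regarded as a family of $q+1$ vectors. Fix a basis $B$ of $\mathbb{F}_q^k$. For an arc $G$, a vector $u\in G$ and a $(k-1)$-subset $C$ of $G$, let $\det(u,C)_B$ be the determinant of the matrix whose first row is $u$ and whose remaining rows are the elements of $C$ in the order inherited from $G$, all written with respect to $B$. For $0\le n\le |G|-k+1$ let $M_G^{\uparrow n}$ be the matrix with rows indexed by the $(k-1)$-subsets $C$ of $G$, columns indexed by the pairs $(U,A)$ with $U$ an $n$-subset of $G$ and $A$ a $(k-2)$-subset of $G\setminus U$ (there are no such pairs if $k=1$), and entries $$M_G^{\uparrow n}(C,(U,A))=\begin{cases}\prod_{u\in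 U}\det(u,C)_B & \text{if } A\subset C\subset G\setminus U,\\ 0 & \text{otherwise.}\end{cases}$$ In the colex order on subsets of $G$, a set $X$ is smaller than a set $Y\neq X$ if the largest element of $X\triangle Y$ in the order of $G$ lies in $Y$. For each $(k-1)$-subset $C$ of $G$ let $L_C$ be the last $n$-subset of $G\setminus C$ in colex order, let $J_G^{\uparrow n}$ be the diagonal matrix with $(C,C)$-entry $\prod_{y\in L_C}\det(y,C)_B^{-1}$, and let $H_G^{\uparrow n}=J_G^{\uparrow n}M_G^{\uparrow n}$, with its rows put in colex order. (The entries of $H_G^{\uparrow n}$ do not depend on $B$.) \textbf{Theorem.} Let $0\le n\le q-2k$. Suppose that for every arc $G\subset\mathbb{F}_q^k$ of size $2k-2+n$ the column space of $H_G^{\uparrow n}$ contains the vector $v\in\mathbb{F}_q^{\binom{2k-2+n}{k-1}}$ with $v_i=1$ for $i\in\{1,\dots,k\}$ and $v_i=0$ otherwise. Then the normal rational curve $\mathcal{R}_k$ is the unique arc in $\mathbb{F}_q^k$ of size $q+1$ up to linear equivalence; that is, $\mathcal{R}_k$ is an arc of size $q+1$, and every arc in $\mathbb{F}_q^k$ of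 size $q+1$ is linearly equivalent to $\mathcal{R}_k$. -/

import Mathlib

namespace ArcMatrix

/-- A finite family of vectors of `F^k` is an arc if it has at least `k` members and every
subfamily of size `k` is a basis of `F^k`. When the index type is `Fin N`, the family is ordered
by its index. -/
def IsArc {F : Type*} [Field F] {k : ℕ} {ι : Type*} [Fintype ι] (G : ι → Fin k → F) : Prop :=
  k ≤ Fintype.card ι ∧
    ∀ s : Finset ι, s.card = k →
      LinearIndependent F (fun i : s => G i) ∧
        Submodule.span F (Set.range fun i : s => G i) = ⊤

/-- Linear equivalence: the matrix with columns `G` becomes the matrix with columns `G'` after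
elementary row operations (left multiplication by an invertible matrix `P`), a permutation `σ` of
the columns and multiplication of the columns by nonzero scalars `c`. -/
def LinearlyEquivalent {F : Type*} [Field F] {k : ℕ} {ι κ : Type*}
    (G : ι → Fin k → F) (G' : κ → Fin k → F) : Prop :=
  ∃ (P : GL (Fin k) F) (σ : κ ≃ ι) (c : κ → Fˣ),
    ∀ j, G' j = (c j : F) • (P : Matrix (Fin k) (Fin k) F).mulVec (G (σ j))

/-- The normal rational curve: `some t` gives `(1, t, ..., t^(k-1))`, and `none` gives
`(0, ..., 0, 1)`. -/
def normalRationalCurve (F : Type*) [Field F] (k : ℕ) : Option F → Fin k → F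
  | some t => fun i => t ^ (i : ℕ)
  | none => fun i => if (i : ℕ) + 1 = k then 1 else 0

/-- The row indices: the `(k-1)`-subsets of the `N` positions of an ordered family. -/
abbrev RowIndex (N k : ℕ) : Type := {C : Finset (Fin N) // C.card + 1 = k}

/-- The column indices: pairs `(U, A)`, with `U` an `n`-subset of the `N` positions and `A` a
`(k-2)`-subset of the complement of `U`. -/
abbrev ColIndex (N k n : ℕ) : Type :=
  {p : Finset (Fin N) × Finset (Fin N) // p.1.card = n ∧ p.2.card + 2 = k ∧ Disjoint p.2 p.1}

section Matrices

variable {F : Type*} [Field F] {k N : ℕ}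

/-- The determinant `det(u, C)_B`: the vector `u` comes first, then the members of `C` in the
order inherited from `G`, all written in the basis `B`. -/
noncomputable def detCons (B : Module.Basis (Fin k) F (Fin k → F)) (G : Fin N → Fin k → F)
    (u : Fin N) (C : RowIndex N k) : F :=
  B.det fun i : Fin k =>
    (Fin.cons (G u) (fun j => G (C.1.orderEmbOfFin rfl j)) : Fin (C.1.card + 1) → Fin k → F)
      (Fin.cast C.2.symm i)

/-- The matrix `M_G^{↑n}`. -/
noncomputable def matM (B : Module.Basis (Fin k) F (Fin k → F)) (G : Fin N → Fin k → F) (n : ℕ) :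
    Matrix (RowIndex N k) (ColIndex N k n) F :=
  Matrix.of fun C p =>
    if p.1.2 ⊆ C.1 ∧ Disjoint C.1 p.1.1 then ∏ u ∈ p.1.1, detCons B G u C else 0

/-- The last `n`-subset of `X` in colex order, that is, the colex-maximum of the finite set of all
`n`-subsets of `X` (which is nonempty when `n ≤ |X|`). -/
def lastSubset (X : Finset (Fin N)) (n : ℕ) : Finset (Fin N) :=
  ofColex ((X.powersetCard n).sup toColex)

/-- The diagonal matrix `J_G^{↑n}`, with `L_C` the last `n`-subset of the complement of `C`. -/
noncomputable def matJ (B : Module.Basis (Fin k) F (Fin k → F)) (G : Fin N → Fin k → F) (n : ℕ) :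
    Matrix (RowIndex N k) (RowIndex N k) F :=
  Matrix.diagonal fun C => ∏ y ∈ lastSubset (C.1)ᶜ n, (detCons B G y C)⁻¹

/-- The matrix `H_G^{↑n} = J_G^{↑n} M_G^{↑n}`. -/
noncomputable def matH (B : Module.Basis (Fin k) F (Fin k → F)) (G : Fin N → Fin k → F) (n : ℕ) :
    Matrix (RowIndex N k) (ColIndex N k n) F :=
  matJ B G n * matM B G n

end Matrices

/-- The position (counted from `1`) of a row when the rows are listed in colex order. -/
def colexPosition {N k : ℕ} (C : RowIndex N k) : ℕ :=
  (Finset.univ.filter fun C' : RowIndex N k => toColex C'.1 ≤ toColex C.1).card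

/-- The vector with entry `1` in the first `k` rows (in colex order) and `0` in all others. -/
def firstOnes (F : Type*) [Field F] (N k : ℕ) : RowIndex N k → F :=
  fun C => if colexPosition C ≤ k then 1 else 0

end ArcMatrix

/-! An arc `S` of size q + 1 produces a left kernel vector of `M_G^{↑n}` for each of its ordered
subarcs G of size 2k - 2 + n, and the hypothesis on `v` turns this vector into an equation that
forces `S` onto a rational curve.

The kernel vector is `rowWeight`: the inverse of ∏ det(y, C) over y in G \ C times ∏ det(s, C) over
s in S \ C. For a column (U, A) only the rows C = A ∪ {e} matter, with e in the k-set E = G \ (A ∪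
U). Projection from A sends S \ A to q + 3 - k points of a projective line, and the relation becomes
a divided difference over E of a polynomial of degree k - 3, which vanishes
(`sum_inv_prod_sub_eq_zero`, `rowWeight_vecMul_matM`).

Pairing with `v` keeps only the rows K \ {i}, where K is the set of the first k members of G. With K
as the standard basis, det(x, K \ {i}) is a multiple of x_i, and what remains is ∑ γ_i ∏_{z ∈ Z}
z_i⁻¹ = 0, with Z the k - 2 members of G after K and γ independent of Z
(`sum_prod_inv_coord_eq_zero`).

Since Z is an arbitrary (k-2)-subset of S \ K, this gives k - 2 independent linear conditions on
coordinatewise inverses, so the inverses of the points of S \ K lie in a plane of F^k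
(`IsArc.inv_mem_span_pair`). Inverting coordinates turns this projective line into a normal rational
curve through K (`linearlyEquivalent_of_inverses_collinear`). -/

namespace ArcMatrix

open Finset Polynomial

/-! ### Interpolation identities over a finite field. -/

section FiniteField

variable {F : Type*} [Field F] [Fintype F] {ι : Type*} [DecidableEq ι]

theorem pow_card_add_one (x : F) : x ^ (Fintype.card F + 1) = x ^ 2 := by
  rw [pow_succ, FiniteField.pow_card, sq]

/-- Wilson's theorem, translated by x ↦ c - x. -/
theorem prod_erase_sub [DecidableEq F] (c : F) :
    ∏ x ∈ univ.erase c, (c - x) = -1 := by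
  have h := FiniteField.prod_univ_units_id_eq_neg_one (K := F)
  have h2 := congrArg (fun u : Fˣ => (u : F)) h
  simp only [Units.coe_prod, Units.val_neg, Units.val_one] at h2
  rw [← h2]
  refine Finset.prod_bij' (fun x hx => Units.mk0 (c - x) (sub_ne_zero.2 (ne_of_mem_erase hx).symm))
    (fun u _ => c - u) ?_ ?_ ?_ ?_ ?_
  · intros; simp
  · intro u _; simp
  · intros; simp
  · intro u _; ext; simp
  · intros; simp

/-- An interpolation identity for distinct elements `a i` of a finite field. -/
theorem sum_inv_prod_sub_eq_zero {E I : Finset ι} (hEI : E ⊆ I)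
    (hc : E.card + I.card = Fintype.card F + 3) {a : ι → F} (ha : Set.InjOn a I) :
    ∑ e ∈ E, (∏ y ∈ E.erase e, (a e - a y))⁻¹ * (∏ s ∈ I.erase e, (a e - a s))⁻¹ = 0 := by
  classical
  -- The values missed by `a`; the cardinality hypothesis makes |T| = |E| - 3.
  set T : Finset F := univ \ I.image a with hT
  have hTc : T.card + 3 = E.card := by
    have h1 : (I.image a).card = I.card := card_image_of_injOn ha
    have h2 : T.card + (I.image a).card = Fintype.card F := by
      rw [hT, card_sdiff_add_card_eq_card (subset_univ _), card_univ]
    omega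
  have hdeg : (Lagrange.nodal T id : F[X]).degree < E.card := by
    rw [Lagrange.degree_nodal]; exact_mod_cast (by omega)
  -- The divided difference over E is the coefficient of degree |E| - 1, and the nodal polynomial of
  -- `T` has smaller degree.
  have key := Lagrange.coeff_eq_sum (ha.mono (by exact_mod_cast hEI)) hdeg
  rw [coeff_eq_zero_of_natDegree_lt (by rw [Lagrange.natDegree_nodal]; omega)] at key
  rw [← neg_eq_zero, key, ← sum_neg_distrib]
  refine sum_congr rfl fun e he => ?_
  -- The values on I \ {e} together with `T` exhaust F \ {a e}, so Wilson trades the product over I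
  -- for a polynomial value.
  have hprod : (∏ s ∈ I.erase e, (a e - a s)) * (Lagrange.nodal T id : F[X]).eval (a e) = -1 := by
    rw [← prod_erase_sub (a e), Lagrange.eval_nodal]
    have h1 : ∏ s ∈ I.erase e, (a e - a s) = ∏ x ∈ (I.image a).erase (a e), (a e - x) := by
      rw [← mul_right_inj' (one_ne_zero (α := F)), one_mul, one_mul]
      symm
      refine (Finset.prod_nbij a ?_ ?_ ?_ ?_).symm
      · intro s hs
        rw [mem_erase] at hs ⊢
        exact ⟨fun h => hs.1 (ha hs.2 (hEI he) h), mem_image_of_mem a hs.2⟩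
      · exact ha.mono (by simp)
      · intro x hx
        simp only [coe_erase, coe_image, Set.mem_sdiff, Set.mem_image, mem_coe,
          Set.mem_singleton_iff] at hx ⊢
        obtain ⟨⟨s, hs, rfl⟩, hne⟩ := hx
        exact ⟨s, ⟨hs, fun h => hne (by rw [h])⟩, rfl⟩
      · intros; rfl
    simp only [h1, id]
    rw [← prod_union]
    · refine prod_congr ?_ fun _ _ => rfl
      ext x
      simp only [hT, mem_union, mem_erase, mem_sdiff, mem_univ, true_and, mem_image, and_true]
      by_cases hx : x = a e
      · subst hx
        exact iff_of_false (fun h => h.elim (fun h => h.1 rfl) fun h => h ⟨e, hEI he, rfl⟩)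
          fun h => h rfl
      · exact iff_of_true ((em _).elim (fun h => Or.inl ⟨hx, h⟩) Or.inr) hx
    · rw [disjoint_left]
      intro x hx hx'
      exact (mem_sdiff.1 hx').2 (mem_erase.1 hx).2
  have hne : (∏ s ∈ I.erase e, (a e - a s)) ≠ 0 := left_ne_zero_of_mul (b := _)
    (by rw [hprod]; exact neg_ne_zero.2 one_ne_zero)
  rw [div_eq_mul_inv, mul_comm (eval _ _), ← mul_neg]
  congr 1
  rw [neg_eq_iff_eq_neg]
  exact inv_eq_of_mul_eq_one_right (by rw [mul_neg, hprod, neg_neg])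

/-- At most `q` pairwise independent points of `F^2` have a common affine chart. -/
theorem exists_affine_chart {I : Finset ι} (hI : I.card ≤ Fintype.card F) {x y : ι → F}
    (hxy : ∀ e ∈ I, ∀ s ∈ I, e ≠ s → x e * y s - y e * x s ≠ 0) (hI2 : 2 ≤ I.card) :
    ∃ μ a : ι → F, (∀ e ∈ I, μ e ≠ 0) ∧
      ∀ e ∈ I, ∀ s ∈ I, x e * y s - y e * x s = μ e * μ s * (a e - a s) := by
  classical
  by_cases h : ∀ e ∈ I, x e ≠ 0
  · refine ⟨x, fun e => -(y e / x e), h, fun e he s hs => ?_⟩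
    have := h e he
    have := h s hs
    field_simp
    ring
  · push Not at h
    obtain ⟨e₀, he₀, hx₀⟩ := h
    have hx : ∀ e ∈ I, e ≠ e₀ → x e ≠ 0 := fun e he hne h0 =>
      hxy e he e₀ he₀ hne (by rw [h0, hx₀]; ring)
    have hy₀ : y e₀ ≠ 0 := by
      obtain ⟨e, he, hne⟩ := exists_mem_ne (by omega : 1 < I.card) e₀
      intro h0
      exact hxy e he e₀ he₀ hne (by rw [h0, hx₀]; ring)
    -- The form αx + y is to play the denominator. It is nonzero at `e₀` for every α, and each of
    -- the at most q - 1 other points excludes one α.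
    obtain ⟨α, hα⟩ : ∃ α : F, α ∉ (I.erase e₀).image fun e => -(y e / x e) := by
      by_contra! hall
      have h1 := card_le_card (s := (univ : Finset F)) (fun α _ => hall α)
      have h2 := card_image_le (s := I.erase e₀) (f := fun e => -(y e / x e))
      rw [card_erase_of_mem he₀] at h2
      rw [card_univ] at h1
      omega
    have hμ : ∀ e ∈ I, α * x e + y e ≠ 0 := by
      intro e he h0
      by_cases hne : e = e₀
      · subst hne; rw [hx₀] at h0; apply hy₀; linear_combination h0
      · refine hα (mem_image.2 ⟨e, mem_erase.2 ⟨hne, he⟩, ?_⟩)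
        have := hx e he hne
        field_simp
        linear_combination -h0
    refine ⟨fun e => α * x e + y e, fun e => x e / (α * x e + y e), hμ, fun e he s hs => ?_⟩
    have h1 := hμ e he
    have h2 := hμ s hs
    dsimp only
    rw [div_sub_div _ _ h1 h2, ← mul_div_assoc, mul_div_cancel_left₀ _ (mul_ne_zero h1 h2)]
    ring

/-- The interpolation identity for pairwise independent points `(x i, y i)` of `F^2`. -/
theorem sum_inv_prod_det_eq_zero {E I : Finset ι} (hEI : E ⊆ I)
    (hc : E.card + I.card = Fintype.card F + 3) (hE : 3 ≤ E.card) {x y : ι → F} {c : F}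
    {d : ι → ι → F} (hd : ∀ e ∈ I, ∀ s ∈ I, d e s = c * (x e * y s - y e * x s))
    (hd0 : ∀ e ∈ I, ∀ s ∈ I, e ≠ s → d e s ≠ 0) :
    ∑ e ∈ E, (∏ s ∈ E.erase e, d e s)⁻¹ * (∏ s ∈ I.erase e, d e s)⁻¹ = 0 := by
  obtain ⟨μ, a, hμ, ha⟩ := exists_affine_chart (I := I) (x := x) (y := y) (by omega)
    (fun e he s hs hne h0 => hd0 e he s hs hne (by rw [hd e he s hs, h0, mul_zero]))
    ((by omega : 2 ≤ E.card).trans (card_le_card hEI))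
  have hinj : Set.InjOn a I := by
    intro e he s hs h
    by_contra hne
    exact hd0 e he s hs hne (by rw [hd e he s hs, ha e he s hs, h]; ring)
  have key := sum_inv_prod_sub_eq_zero hEI hc hinj
  have hterm : ∀ X ⊆ I, ∀ e ∈ X, μ e * ∏ s ∈ X.erase e, d e s =
      c ^ (X.card - 1) * μ e ^ (X.card - 1) * (∏ s ∈ X, μ s) * ∏ s ∈ X.erase e, (a e - a s) := by
    intro X hX e he
    have h1 : ∏ s ∈ X.erase e, d e s = ∏ s ∈ X.erase e, (c * μ e * μ s * (a e - a s)) :=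
      prod_congr rfl fun s hs => by
        rw [hd e (hX he) s (hX (mem_of_mem_erase hs)), ha e (hX he) s (hX (mem_of_mem_erase hs))]
        ring
    rw [h1, prod_mul_distrib, prod_mul_distrib, prod_const, card_erase_of_mem he,
      ← mul_prod_erase X μ he, mul_pow]
    ring
  -- The total degree q + 1 acts as degree 2 on F. The resulting `μ e ^ 2` cancels against the two
  -- factors `μ e` that complete the products over E and I, so the scaling does not depend on `e`.
  have hcc : (E.card - 1) + (I.card - 1) = Fintype.card F + 1 := by
    have := card_le_card hEI; omega
  have hsum : ∀ e ∈ E, (∏ s ∈ E.erase e, d e s)⁻¹ * (∏ s ∈ I.erase e, d e s)⁻¹ =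
      (c ^ 2 * (∏ s ∈ E, μ s) * ∏ s ∈ I, μ s)⁻¹ *
        ((∏ y ∈ E.erase e, (a e - a y))⁻¹ * (∏ s ∈ I.erase e, (a e - a s))⁻¹) := by
    intro e he
    have hp : μ e ^ 2 * ((∏ s ∈ E.erase e, d e s) * ∏ s ∈ I.erase e, d e s) =
        μ e ^ 2 * ((c ^ 2 * (∏ s ∈ E, μ s) * ∏ s ∈ I, μ s) *
          ((∏ y ∈ E.erase e, (a e - a y)) * ∏ s ∈ I.erase e, (a e - a s))) := by
      calc _ = (μ e * ∏ s ∈ E.erase e, d e s) * (μ e * ∏ s ∈ I.erase e, d e s) := by ring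
        _ = c ^ ((E.card - 1) + (I.card - 1)) * μ e ^ ((E.card - 1) + (I.card - 1)) *
            (((∏ s ∈ E, μ s) * ∏ s ∈ I, μ s) *
          ((∏ y ∈ E.erase e, (a e - a y)) * ∏ s ∈ I.erase e, (a e - a s))) := by
            rw [hterm E hEI e he, hterm I subset_rfl e (hEI he), pow_add, pow_add]; ring
        _ = _ := by rw [hcc, pow_card_add_one, pow_card_add_one]; ring
    rw [← mul_inv, mul_left_cancel₀ (pow_ne_zero 2 (hμ e (hEI he))) hp, mul_inv, ← mul_inv (∏ y ∈ _, _)]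
  rw [sum_congr rfl hsum, ← mul_sum, key, mul_zero]

end FiniteField

end ArcMatrix

namespace ArcMatrix

open Finset Polynomial

theorem LinearlyEquivalent.of_mulVec {F : Type*} [Field F] {k : ℕ} {ι κ : Type*}
    {G : ι → Fin k → F} {G' : κ → Fin k → F}
    (P : GL (Fin k) F) (h : LinearlyEquivalent (fun i => (P : Matrix (Fin k) (Fin k) F).mulVec (G i)) G') :
    LinearlyEquivalent G G' := by
  obtain ⟨Q, σ, c, h⟩ := h
  refine ⟨Q * P, σ, c, fun j => ?_⟩
  rw [h, Units.val_mul, Matrix.mulVec_mulVec]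

/-! ### Arcs and their subfamilies. -/

section Arcs

variable {F : Type*} [Field F] {k : ℕ} {ι κ : Type*} [Fintype ι] [Fintype κ]

theorem IsArc.linearIndependent_finset {G : ι → Fin k → F} (hG : IsArc G) {s : Finset ι}
    (hs : s.card ≤ k) : LinearIndependent F fun i : s => G i := by
  obtain ⟨t, hst, -, ht⟩ := exists_subsuperset_card_eq (subset_univ s) hs
    (by rw [card_univ]; exact hG.1)
  exact (hG.2 t ht).1.comp (Set.inclusion hst) (Set.inclusion_injective hst)

theorem IsArc.linearIndependent_comp {G : ι → Fin k → F} (hG : IsArc G) {m : ℕ} (hm : m ≤ k)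
    {f : Fin m → ι} (hf : Function.Injective f) : LinearIndependent F (G ∘ f) := by
  have h := hG.linearIndependent_finset (s := univ.map ⟨f, hf⟩) (by simpa using hm)
  exact h.comp (fun i => ⟨f i, by simp⟩) fun i j hij => hf (congrArg Subtype.val hij)

theorem isArc_iff {G : ι → Fin k → F} :
    IsArc G ↔ k ≤ Fintype.card ι ∧
      ∀ f : Fin k → ι, Function.Injective f → LinearIndependent F (G ∘ f) := by
  refine ⟨fun h => ⟨h.1, fun f hf => h.linearIndependent_comp le_rfl hf⟩, fun h => ⟨h.1, ?_⟩⟩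
  intro s hs
  have e : Fin k ≃ s := (s.equivFinOfCardEq hs).symm
  have hli : LinearIndependent F fun i : s => G i := by
    have h1 := (h.2 (fun i => e i) (Subtype.val_injective.comp e.injective)).comp e.symm
      e.symm.injective
    convert h1 using 1
    ext i : 1
    simp
  refine ⟨hli, hli.span_eq_top_of_card_eq_finrank' ?_⟩
  simp [hs]

theorem IsArc.comp {G : ι → Fin k → F} (hG : IsArc G) (hk : k ≤ Fintype.card κ) {g : κ → ι}
    (hg : Function.Injective g) : IsArc (G ∘ g) :=
  isArc_iff.2 ⟨hk, fun _ hf => hG.linearIndependent_comp le_rfl (hg.comp hf)⟩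

theorem IsArc.mulVec {G : ι → Fin k → F} (hG : IsArc G) (P : GL (Fin k) F) :
    IsArc fun i => (P : Matrix (Fin k) (Fin k) F).mulVec (G i) := by
  refine isArc_iff.2 ⟨hG.1, fun f hf => ?_⟩
  refine (hG.linearIndependent_comp le_rfl hf).map'
    (P : Matrix (Fin k) (Fin k) F).mulVecLin (LinearMap.ker_eq_bot.2 ?_)
  exact Matrix.mulVec_injective_of_isUnit P.isUnit

end Arcs

/-! ### The normal rational curve and its recognition. -/

section NormalRationalCurve

variable {F : Type*} [Field F] [Fintype F] {k : ℕ}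

theorem isArc_normalRationalCurve (hk : k ≤ Fintype.card F + 1) :
    IsArc (normalRationalCurve F k) := by
  refine isArc_iff.2 ⟨by simpa using hk, fun f hf => ?_⟩
  -- Homogeneous parameters (t : 1), with (1 : 0) for the point at infinity, make any k points of
  -- the curve the rows of a projective Vandermonde matrix.
  let v : Option F → F := fun o => o.elim 1 id
  let w : Option F → F := fun o => o.elim 0 fun _ => 1
  have hM : (normalRationalCurve F k ∘ f : Fin k → Fin k → F) =
      (Matrix.projVandermonde (v ∘ f) (w ∘ f)).row := by
    funext i j
    simp only [Function.comp, Matrix.row, Matrix.projVandermonde_apply]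
    rcases f i with _ | t
    · simp only [normalRationalCurve, v, w, Option.elim, one_pow, one_mul, Fin.val_rev]
      split_ifs with h
      · rw [h, Nat.sub_self, pow_zero]
      · rw [zero_pow (by omega)]
    · simp [normalRationalCurve, v, w]
  rw [hM, Matrix.linearIndependent_rows_iff_isUnit, Matrix.isUnit_iff_isUnit_det, isUnit_iff_ne_zero,
    Matrix.det_projVandermonde]
  refine prod_ne_zero_iff.2 fun i _ => prod_ne_zero_iff.2 fun j hj => ?_
  have hij : f i ≠ f j := fun h => (mem_Ioi.1 hj).ne (hf h)
  simp only [Function.comp]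
  revert hij
  rcases f i with _ | s <;> rcases f j with _ | t <;> simp [v, w, sub_eq_zero, eq_comm]

/-- A parametrization of an arc of size `q + 1` by the normal rational curve is a linear
equivalence. -/
theorem linearlyEquivalent_of_param {ι : Type*} [Fintype ι] (hk : 2 ≤ k)
    (hι : Fintype.card ι = Fintype.card F + 1) {S : ι → Fin k → F} (hS : IsArc S)
    (Q : Matrix (Fin k) (Fin k) F)
    (h : ∀ s, ∃ x : Option F, ∃ d : F, d ≠ 0 ∧ S s = d • Q.mulVec (normalRationalCurve F k x)) :
    LinearlyEquivalent S (normalRationalCurve F k) := by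
  choose f d hd hf using h
  have hinj : Function.Injective f := by
    intro s t hst
    by_contra hne
    have hli := hS.linearIndependent_comp hk (f := ![s, t]) (by
      intro i j hij
      fin_cases i <;> fin_cases j <;> simp_all [eq_comm])
    have h0 := Fintype.linearIndependent_iff.1 hli ![d t, -d s] (by
      simp only [Function.comp, Fin.sum_univ_two, Matrix.cons_val_zero, Matrix.cons_val_one]
      rw [hf s, hf t, hst, smul_smul, smul_smul, ← add_smul]
      rw [show d t * d s + -d s * d t = 0 by ring, zero_smul]) 0
    exact hd t h0
  have hbij : Function.Bijective f :=
    (Fintype.bijective_iff_injective_and_card f).2 ⟨hinj, by rw [hι, Fintype.card_option]⟩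
  have hsurj : Function.Surjective Q.mulVec := by
    have h1 : LinearMap.range Q.mulVecLin = ⊤ := by
      obtain ⟨s, -, hs⟩ := exists_subset_card_eq (s := (univ : Finset ι)) (n := k)
        (by rw [card_univ]; exact hS.1)
      rw [eq_top_iff, ← (hS.2 s hs).2, Submodule.span_le]
      rintro _ ⟨i, rfl⟩
      exact ⟨d i • normalRationalCurve F k (f i), by
        dsimp only; rw [hf i]; simp⟩
    exact LinearMap.range_eq_top.1 h1
  obtain ⟨P, rfl⟩ := Matrix.mulVec_surjective_iff_isUnit.1 hsurj
  refine ⟨P⁻¹, (Equiv.ofBijective f hbij).symm, fun j =>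
    (Units.mk0 _ (hd ((Equiv.ofBijective f hbij).symm j)))⁻¹, fun j => ?_⟩
  have hj : f ((Equiv.ofBijective f hbij).symm j) = j := (Equiv.ofBijective f hbij).apply_symm_apply j
  rw [hf, hj, Matrix.mulVec_smul, Matrix.mulVec_mulVec, smul_smul, Units.inv_mul]
  simp [hd]

/-- If the coordinatewise inverses of the members of an arc outside a standard basis lie on a
line, then the arc is a normal rational curve. -/
theorem linearlyEquivalent_of_inverses_collinear {ι : Type*} [Fintype ι] (hk : 2 ≤ k)
    (hι : Fintype.card ι = Fintype.card F + 1) {S : ι → Fin k → F} (hS : IsArc S)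
    {κ : Fin k → ι} (hκ : ∀ i, S (κ i) = Pi.single i 1) {a θ : Fin k → F} (ha : ∀ i, a i ≠ 0)
    (hθ : Function.Injective θ)
    (h : ∀ s, s ∉ Set.range κ → ∃ l m : F, ∀ i, S s i * (a i * (l + m * θ i)) = 1) :
    LinearlyEquivalent S (normalRationalCurve F k) := by
  -- Clearing denominators in 1 / (a_i (l + m θ_i)) gives the values of `p i` at -l/m, up to a
  -- common scalar. The parameter θ_i gives the i-th basis vector, and m = 0 gives the leading
  -- coefficients, the image of `none`.
  let p : Fin k → F[X] := fun i => C (a i)⁻¹ * Lagrange.nodal (univ.erase i) θ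
  have hdeg : ∀ i, (p i).natDegree = k - 1 := fun i => by
    rw [natDegree_C_mul (inv_ne_zero (ha i)), Lagrange.natDegree_nodal, card_erase_of_mem (mem_univ _),
      card_univ, Fintype.card_fin]
  let Q : Matrix (Fin k) (Fin k) F := Matrix.of fun i j => (p i).coeff j
  have hsome : ∀ x i, Q.mulVec (normalRationalCurve F k (some x)) i =
      (a i)⁻¹ * ∏ j ∈ univ.erase i, (x - θ j) := fun x i => by
    have h1 : (p i).eval x = (a i)⁻¹ * ∏ j ∈ univ.erase i, (x - θ j) := by
      simp [p, Lagrange.eval_nodal]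
    rw [← h1, eval_eq_sum_range' (n := k) (by rw [hdeg]; omega), sum_range]
    rfl
  have hnone : ∀ i, Q.mulVec (normalRationalCurve F k none) i = (a i)⁻¹ := fun i => by
    have h1 : (p i).coeff (k - 1) = (a i)⁻¹ := by
      rw [← hdeg i, coeff_natDegree]
      simp only [p]
      rw [leadingCoeff_C_mul_of_isUnit (inv_ne_zero (ha i)).isUnit, Lagrange.nodal_monic.leadingCoeff,
        mul_one]
    rw [← h1]
    simp only [Matrix.mulVec, dotProduct, normalRationalCurve, Q, Matrix.of_apply]
    rw [sum_eq_single (⟨k - 1, by omega⟩ : Fin k)]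
    · rw [if_pos (by simp only; omega), mul_one]
    · intro j _ hj
      rw [if_neg (fun h => hj (Fin.ext (by simp only; omega))), mul_zero]
    · simp
  refine linearlyEquivalent_of_param hk hι hS Q fun s => ?_
  by_cases hs : s ∈ Set.range κ
  · obtain ⟨i, rfl⟩ := hs
    have hne : (a i)⁻¹ * ∏ j ∈ univ.erase i, (θ i - θ j) ≠ 0 :=
      mul_ne_zero (inv_ne_zero (ha i)) (prod_ne_zero_iff.2 fun j hj =>
        sub_ne_zero.2 fun h => (ne_of_mem_erase hj) (hθ h).symm)
    refine ⟨some (θ i), _, inv_ne_zero hne, ?_⟩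
    funext j
    rw [hκ, Pi.smul_apply, hsome, smul_eq_mul]
    by_cases hj : j = i
    · subst hj
      rw [Pi.single_eq_same, inv_mul_cancel₀ hne]
    · rw [Pi.single_eq_of_ne hj, prod_eq_zero (i := i) (mem_erase.2 ⟨Ne.symm hj, mem_univ _⟩)
        (sub_self _), mul_zero, mul_zero]
  · obtain ⟨l, m, hlm⟩ := h s hs
    have hi0 : ∀ i, S s i = (a i)⁻¹ * (l + m * θ i)⁻¹ := fun i => by
      rw [← mul_inv]; exact eq_inv_of_mul_eq_one_left (hlm i)
    have hne : ∀ i, l + m * θ i ≠ 0 := fun i h0 => by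
      have := hlm i; rw [h0] at this; simp at this
    by_cases hm : m = 0
    · subst hm
      have hl : l ≠ 0 := by simpa using hne ⟨0, by omega⟩
      refine ⟨none, l⁻¹, inv_ne_zero hl, funext fun i => ?_⟩
      rw [Pi.smul_apply, hnone, hi0, smul_eq_mul]
      simp [mul_comm]
    · have hne' : ∀ i, -l / m - θ i ≠ 0 := fun i h0 => hne i (by
        have h1 : l = -(m * (-l / m)) := by field_simp
        rw [h1, sub_eq_zero.1 h0]; ring)
      have hP : ∏ j, (-l / m - θ j) ≠ 0 := prod_ne_zero_iff.2 fun j _ => hne' j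
      refine ⟨some (-l / m), -(m * ∏ j, (-l / m - θ j))⁻¹,
        neg_ne_zero.2 (inv_ne_zero (mul_ne_zero hm hP)), funext fun i => ?_⟩
      rw [Pi.smul_apply, hsome, hi0, smul_eq_mul, ← mul_prod_erase univ _ (mem_univ i)]
      have hE : ∏ j ∈ univ.erase i, (-l / m - θ j) ≠ 0 := prod_ne_zero_iff.2 fun j _ => hne' j
      have h1 : l + m * θ i = -(m * (-l / m - θ i)) := by field_simp; ring
      rw [h1, mul_inv, mul_inv, inv_neg, mul_inv]
      have hw := hne' i
      generalize ∏ j ∈ univ.erase i, (-l / m - θ j) = E at hE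
      generalize -l / m - θ i = w at hw
      field_simp

end NormalRationalCurve

end ArcMatrix

namespace ArcMatrix

open Finset

/-! ### From the vanishing form to collinear inverses. -/

section Collinear

variable {F : Type*} [Field F] {k : ℕ} {ι : Type*} [Fintype ι]

theorem IsArc.eq_zero_of_dotProduct_eq_zero {G : ι → Fin k → F} (hG : IsArc G) {T : Finset ι}
    (hT : T.card = k) {φ : Fin k → F} (h : ∀ t ∈ T, φ ⬝ᵥ G t = 0) : φ = 0 := by
  have h1 : ∀ v : Fin k → F, dotProductBilin F F φ v = 0 := fun v => by
    have hv : v ∈ Submodule.span F (Set.range fun i : T => G i) := by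
      rw [(hG.2 T hT).2]; trivial
    have hle : Submodule.span F (Set.range fun i : T => G i) ≤
        LinearMap.ker (dotProductBilin F F φ) := by
      rw [Submodule.span_le]
      rintro _ ⟨t, rfl⟩
      exact h t t.2
    exact hle hv
  funext i
  simpa using h1 (Pi.single i 1)

/-- Otherwise the hyperplane x_i = 0 contains s and k - 1 basis vectors. -/
theorem IsArc.coord_ne_zero {S : ι → Fin k → F} (hS : IsArc S) {κ : Fin k → ι}
    (hκi : Function.Injective κ) (hκ : ∀ i, S (κ i) = Pi.single i 1) {s : ι}
    (hs : s ∉ Set.range κ) (i : Fin k) : S s i ≠ 0 := by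
  classical
  intro h0
  have h1 := hS.eq_zero_of_dotProduct_eq_zero (T := insert s ((univ.erase i).image κ))
    (φ := Pi.single i 1) (by
      rw [card_insert_of_notMem, card_image_of_injective _ hκi, card_erase_of_mem (mem_univ _),
        card_univ, Fintype.card_fin]
      · have := i.2; omega
      · intro h
        obtain ⟨j, -, rfl⟩ := mem_image.1 h
        exact hs ⟨j, rfl⟩) (by
      intro t ht
      rw [mem_insert, mem_image] at ht
      rcases ht with rfl | ⟨j, hj, rfl⟩
      · simpa using h0
      · rw [hκ, single_dotProduct, one_mul, Pi.single_eq_of_ne (ne_of_mem_erase hj).symm])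
  exact one_ne_zero (α := F) (by simpa using congrFun h1 i)

/-- Otherwise the hyperplane s_j x_i = s_i x_j contains s, t and k - 2 basis vectors. -/
theorem IsArc.coord_minor_ne_zero {S : ι → Fin k → F} (hS : IsArc S) {κ : Fin k → ι}
    (hκi : Function.Injective κ) (hκ : ∀ i, S (κ i) = Pi.single i 1) {s t : ι}
    (hs : s ∉ Set.range κ) (ht : t ∉ Set.range κ) (hst : s ≠ t) {i j : Fin k} (hij : i ≠ j) :
    S s j * S t i - S s i * S t j ≠ 0 := by
  classical
  intro h0
  have h1 := hS.eq_zero_of_dotProduct_eq_zero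
    (T := insert s (insert t (((univ.erase i).erase j).image κ)))
    (φ := Pi.single i (S s j) - Pi.single j (S s i)) (by
      rw [card_insert_of_notMem, card_insert_of_notMem, card_image_of_injective _ hκi,
        card_erase_of_mem (mem_erase.2 ⟨hij.symm, mem_univ _⟩), card_erase_of_mem (mem_univ _),
        card_univ, Fintype.card_fin]
      · have := i.2; have := j.2; have := Fin.val_ne_of_ne hij; omega
      · intro h
        obtain ⟨j, -, rfl⟩ := mem_image.1 h
        exact ht ⟨j, rfl⟩
      · intro h
        obtain h | h := mem_insert.1 h
        · exact hst h
        obtain ⟨j, -, rfl⟩ := mem_image.1 h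
        exact hs ⟨j, rfl⟩) (by
      intro r hr
      rw [mem_insert, mem_insert, mem_image] at hr
      rw [sub_dotProduct, single_dotProduct, single_dotProduct]
      rcases hr with rfl | rfl | ⟨l, hl, rfl⟩
      · ring
      · exact h0
      · rw [mem_erase, mem_erase] at hl
        rw [hκ, Pi.single_eq_of_ne hl.1.symm, Pi.single_eq_of_ne hl.2.1.symm]
        ring)
  have h2 := congrFun h1 j
  rw [Pi.sub_apply, Pi.single_eq_of_ne hij.symm, Pi.single_eq_same, zero_sub, Pi.zero_apply,
    neg_eq_zero] at h2
  exact hS.coord_ne_zero hκi hκ hs i h2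

/-- A diagonal symmetric form of degree `k - 2` which vanishes on all distinct inverses of members
of an arc outside a standard basis forces these inverses to lie on a line. -/
theorem IsArc.inv_mem_span_pair {S : ι → Fin k → F} (hS : IsArc S) (hk : 2 ≤ k)
    (hι : 2 * k + 1 ≤ Fintype.card ι) {κ : Fin k → ι} (hκi : Function.Injective κ)
    (hκ : ∀ i, S (κ i) = Pi.single i 1) {γ : Fin k → F} (hγ : ∀ i, γ i ≠ 0)
    (h : 3 ≤ k → ∀ Z : Finset ι, (∀ z ∈ Z, z ∉ Set.range κ) → Z.card = k - 2 →
      ∑ i, (∏ z ∈ Z, (S z i)⁻¹) * γ i = 0)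
    {z₁ z₂ s : ι} (hz₁ : z₁ ∉ Set.range κ) (hz₂ : z₂ ∉ Set.range κ) (hs : s ∉ Set.range κ)
    (hz : z₁ ≠ z₂) :
    ∃ l m : F, ∀ i, (S s i)⁻¹ = l * (S z₁ i)⁻¹ + m * (S z₂ i)⁻¹ := by
  classical
  let x : ι → Fin k → F := fun s i => (S s i)⁻¹
  obtain ⟨W, hWs, hW⟩ := exists_subset_card_eq
    (s := ((((univ : Finset ι) \ univ.image κ).erase z₁).erase z₂).erase s) (n := k - 2) (by
      have h1 := card_sdiff_add_card_eq_card (subset_univ (univ.image κ))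
      rw [card_image_of_injective _ hκi, card_univ, card_univ, Fintype.card_fin] at h1
      have h2 := pred_card_le_card_erase (s := (univ : Finset ι) \ univ.image κ) (a := z₁)
      have h3 := pred_card_le_card_erase (s := ((univ : Finset ι) \ univ.image κ).erase z₁) (a := z₂)
      have h4 := pred_card_le_card_erase
        (s := (((univ : Finset ι) \ univ.image κ).erase z₁).erase z₂) (a := s)
      omega)
  have hWmem : ∀ w ∈ W, w ≠ s ∧ w ≠ z₂ ∧ w ≠ z₁ ∧ w ∉ Set.range κ := fun w hw => by
    simpa using hWs hw
  let D : Fin k → F := fun i => (∏ w ∈ W, (S w i)⁻¹) * γ i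
  have hD : ∀ i, D i ≠ 0 := fun i => mul_ne_zero (prod_ne_zero_iff.2 fun w hw =>
    inv_ne_zero (hS.coord_ne_zero hκi hκ (hWmem w hw).2.2.2 i)) (hγ i)
  -- The factor `S w i` removes `w` from the product over `W`; pairing with `x z` then puts `z` in
  -- its place, so the row of `w` is the condition `h` for `W` with `w` replaced by `z`.
  let A : Matrix W (Fin k) F := Matrix.of fun w i => D i * S w i
  have hker : ∀ z, z ∉ Set.range κ → z ∉ W → x z ∈ LinearMap.ker A.mulVecLin := by
    intro z hz hzW
    rw [LinearMap.mem_ker, Matrix.mulVecLin_apply]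
    funext w
    -- A row exists only if k ≥ 3; for k = 2 the kernel is the whole plane and `h` is not needed.
    have h1 : (W.card : ℕ) ≠ 0 := (card_pos.2 ⟨w.1, w.2⟩).ne'
    have h2 := h (by omega) (insert z (W.erase w)) (by
      intro y hy
      obtain rfl | hy := mem_insert.1 hy
      · exact hz
      · exact (hWmem y (mem_of_mem_erase hy)).2.2.2) (by
      rw [card_insert_of_notMem (fun h => hzW (mem_of_mem_erase h)), card_erase_of_mem w.2]
      omega)
    rw [Pi.zero_apply, ← h2]
    change ∑ i, A w i * x z i = _
    refine sum_congr rfl fun i _ => ?_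
    rw [prod_insert (fun h => hzW (mem_of_mem_erase h))]
    simp only [A, D, x, Matrix.of_apply]
    rw [← mul_prod_erase W (fun y => (S y i)⁻¹) w.2]
    have := hS.coord_ne_zero hκi hκ (hWmem w w.2).2.2.2 i
    field_simp
  have hrank : Module.finrank F (LinearMap.range A.mulVecLin) = k - 2 := by
    have hli : LinearIndependent F A.row := by
      have h1 : LinearIndependent F ((Matrix.diagonal D).mulVecLin ∘ fun w : W => S w) := (hS.linearIndependent_finset (s := W) (by omega)).map'
        (Matrix.diagonal D).mulVecLin (LinearMap.ker_eq_bot.2 (Matrix.mulVec_injective_of_isUnit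
          ((Matrix.isUnit_iff_isUnit_det _).2 (by
            rw [Matrix.det_diagonal, isUnit_iff_ne_zero]
            exact prod_ne_zero_iff.2 fun i _ => hD i))))
      have h2 : A.row = (Matrix.diagonal D).mulVecLin ∘ fun w : W => S w := by
        funext w i
        simp [A, Matrix.mulVec_diagonal]
      rw [h2]
      exact h1
    have h2 := hli.rank_matrix
    rw [Fintype.card_coe, hW] at h2
    exact h2
  have hkerdim : Module.finrank F (LinearMap.ker A.mulVecLin) = 2 := by
    have := A.mulVecLin.finrank_range_add_finrank_ker
    rw [hrank, Module.finrank_fin_fun] at this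
    omega
  have hli : LinearIndependent F ![x z₁, x z₂] := by
    rw [LinearIndependent.pair_iff]
    intro l m hlm
    let i : Fin k := ⟨0, by omega⟩
    let j : Fin k := ⟨1, by omega⟩
    have hij : i ≠ j := by simp [i, j, Fin.ext_iff]
    have hi : l * (S z₁ i)⁻¹ + m * (S z₂ i)⁻¹ = 0 := congrFun hlm i
    have hj : l * (S z₁ j)⁻¹ + m * (S z₂ j)⁻¹ = 0 := congrFun hlm j
    have hd := hS.coord_minor_ne_zero hκi hκ hz₁ hz₂ hz hij
    have h1 := hS.coord_ne_zero hκi hκ hz₁ i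
    have h2 := hS.coord_ne_zero hκi hκ hz₂ i
    have h3 := hS.coord_ne_zero hκi hκ hz₁ j
    have h4 := hS.coord_ne_zero hκi hκ hz₂ j
    field_simp at hi hj
    have hl : l = 0 := by
      apply mul_right_cancel₀ hd
      linear_combination S z₁ j * hi - S z₁ i * hj
    have hm : m = 0 := by
      rw [hl, zero_mul, zero_add] at hi
      apply mul_right_cancel₀ h1
      linear_combination hi
    exact ⟨hl, hm⟩
  have hspan : Submodule.span F (Set.range ![x z₁, x z₂]) = LinearMap.ker A.mulVecLin := by
    refine Submodule.eq_of_le_of_finrank_eq ?_ ?_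
    · rw [Submodule.span_le]
      rintro _ ⟨i, rfl⟩
      fin_cases i
      · exact hker z₁ hz₁ fun h => (hWmem _ h).2.2.1 rfl
      · exact hker z₂ hz₂ fun h => (hWmem _ h).2.1 rfl
    · rw [finrank_span_eq_card hli, hkerdim, Fintype.card_fin]
  have hmem := hker s hs fun h => (hWmem _ h).1 rfl
  rw [← hspan, Matrix.range_cons, Matrix.range_cons, Matrix.range_empty, Set.union_empty,
    Set.singleton_union, Submodule.mem_span_pair] at hmem
  obtain ⟨l, m, hlm⟩ := hmem
  exact ⟨l, m, fun i => (congrFun hlm i).symm⟩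

/-- Two points z₁, z₂ outside the basis span the line of inverses: a = z₁⁻¹ and aθ = z₂⁻¹, and the
θ_i are distinct because the 2 × 2 minors are nonzero. -/
theorem linearlyEquivalent_of_form_vanishes [Fintype F] {S : ι → Fin k → F} (hS : IsArc S)
    (hk : 2 ≤ k) (hq : 2 * k ≤ Fintype.card F) (hι : Fintype.card ι = Fintype.card F + 1)
    {κ : Fin k → ι} (hκi : Function.Injective κ)
    (hκ : ∀ i, S (κ i) = Pi.single i 1) {γ : Fin k → F} (hγ : ∀ i, γ i ≠ 0)
    (h : 3 ≤ k → ∀ Z : Finset ι, (∀ z ∈ Z, z ∉ Set.range κ) → Z.card = k - 2 →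
      ∑ i, (∏ z ∈ Z, (S z i)⁻¹) * γ i = 0) :
    LinearlyEquivalent S (normalRationalCurve F k) := by
  classical
  obtain ⟨z₁, hz₁, z₂, hz₂, hz⟩ := one_lt_card.1
    (show 1 < ((univ : Finset ι) \ univ.image κ).card by
      have h1 := card_sdiff_add_card_eq_card (subset_univ (univ.image κ))
      rw [card_image_of_injective _ hκi, card_univ, card_univ, Fintype.card_fin] at h1
      omega)
  replace hz₁ : z₁ ∉ Set.range κ := by simpa using hz₁
  replace hz₂ : z₂ ∉ Set.range κ := by simpa using hz₂
  have h₁ := hS.coord_ne_zero hκi hκ hz₁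
  have h₂ := hS.coord_ne_zero hκi hκ hz₂
  refine linearlyEquivalent_of_inverses_collinear hk hι hS hκ
    (a := fun i => (S z₁ i)⁻¹) (θ := fun i => S z₁ i / S z₂ i) (fun i => inv_ne_zero (h₁ i)) ?_ ?_
  · intro i j hij
    by_contra hne
    refine hS.coord_minor_ne_zero hκi hκ hz₁ hz₂ hz hne ?_
    have := h₂ i
    have := h₂ j
    field_simp at hij
    linear_combination -hij
  · intro s hs
    obtain ⟨l, m, hlm⟩ := hS.inv_mem_span_pair hk (by omega) hκi hκ hγ h hz₁ hz₂ hs hz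
    refine ⟨l, m, fun i => ?_⟩
    have h3 : (S z₁ i)⁻¹ * (l + m * (S z₁ i / S z₂ i)) = (S s i)⁻¹ := by
      rw [hlm]
      have := h₁ i
      have := h₂ i
      field_simp
    rw [h3, mul_inv_cancel₀ (hS.coord_ne_zero hκi hκ hs i)]

end Collinear

end ArcMatrix

namespace ArcMatrix

open Finset

/-! ### Determinants as linear and bilinear forms. -/

section RowForm

variable {F : Type*} [Field F] {m N : ℕ} {ι : Type*}

/-- Two enumerations of the same set give the same values of alternating forms, up to a sign. -/
theorem exists_sign_of_range_eq {M : Type*} [AddCommGroup M] [Module F M] {f g : Fin m → ι}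
    (hf : Function.Injective f) (hg : Function.Injective g) (h : Set.range f = Set.range g)
    (G : ι → M) :
    ∃ ε : F, ε ^ 2 = 1 ∧ ∀ Φ : M [⋀^Fin m]→ₗ[F] F, Φ (G ∘ f) = ε * Φ (G ∘ g) := by
  let σ : Equiv.Perm (Fin m) :=
    (Equiv.ofInjective f hf).trans ((Equiv.setCongr h).trans (Equiv.ofInjective g hg).symm)
  have hσ : ∀ i, g (σ i) = f i := fun i => by
    simp [σ, Equiv.apply_ofInjective_symm]
  refine ⟨((Equiv.Perm.sign σ : ℤ) : F), ?_, fun Φ => ?_⟩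
  · rw [← Int.cast_pow, ← Units.val_pow_eq_pow_val, Int.units_sq]; simp
  · have h1 : G ∘ f = (G ∘ g) ∘ σ := by
      funext i; simp [hσ]
    rw [h1, Φ.map_perm, Units.smul_def, zsmul_eq_mul]

theorem IsArc.det_ne_zero [Fintype ι] {k : ℕ} {S : ι → Fin k → F} (hS : IsArc S)
    (B : Module.Basis (Fin k) F (Fin k → F)) {f : Fin k → ι} (hf : Function.Injective f) :
    B.det (S ∘ f) ≠ 0 := by
  have hli := hS.linearIndependent_comp le_rfl hf
  exact (B.is_basis_iff_det.1 ⟨hli, hli.span_eq_top_of_card_eq_finrank' (by simp)⟩).ne_zero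

/-- The linear form `v ↦ det(v, C)`. -/
noncomputable def rowForm (B : Module.Basis (Fin (m + 1)) F (Fin (m + 1) → F))
    (G : Fin N → Fin (m + 1) → F) (C : RowIndex N (m + 1)) : (Fin (m + 1) → F) →ₗ[F] F where
  toFun v := B.det.curryLeft v (G ∘ C.1.orderEmbOfFin (Nat.succ_injective C.2))
  map_add' v w := by rw [map_add, AlternatingMap.add_apply]
  map_smul' a v := by rw [map_smul, AlternatingMap.smul_apply]; rfl

theorem rowForm_apply (B : Module.Basis (Fin (m + 1)) F (Fin (m + 1) → F))
    (G : Fin N → Fin (m + 1) → F) (C : RowIndex N (m + 1)) (v : Fin (m + 1) → F) :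
    rowForm B G C v = B.det.curryLeft v (G ∘ C.1.orderEmbOfFin (Nat.succ_injective C.2)) := rfl

theorem detCons_eq_rowForm (B : Module.Basis (Fin (m + 1)) F (Fin (m + 1) → F))
    (G : Fin N → Fin (m + 1) → F) (u : Fin N) (C : RowIndex N (m + 1)) :
    detCons B G u C = rowForm B G C (G u) := by
  rw [rowForm_apply, AlternatingMap.curryLeft_apply_apply, detCons]
  congr 1
  funext i
  refine Fin.cases ?_ (fun j => ?_) i
  · rfl
  · rfl

theorem rowForm_apply_of_mem (B : Module.Basis (Fin (m + 1)) F (Fin (m + 1) → F))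
    (G : Fin N → Fin (m + 1) → F) {C : RowIndex N (m + 1)} {u : Fin N} (hu : u ∈ C.1) :
    rowForm B G C (G u) = 0 := by
  rw [rowForm_apply, AlternatingMap.curryLeft_apply_apply]
  obtain ⟨j, hj⟩ : ∃ j, C.1.orderEmbOfFin (Nat.succ_injective C.2) j = u := by
    have : u ∈ Set.range (C.1.orderEmbOfFin (Nat.succ_injective C.2)) := by
      rw [range_orderEmbOfFin]; exact hu
    exact this
  exact AlternatingMap.map_eq_zero_of_eq _ _ (i := 0) (j := j.succ)
    (by simp [hj]) (Fin.succ_ne_zero j).symm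

theorem IsArc.rowForm_ne_zero [Fintype ι] {S : ι → Fin (m + 1) → F} (hS : IsArc S)
    (B : Module.Basis (Fin (m + 1)) F (Fin (m + 1) → F)) {g : Fin N → ι}
    (hg : Function.Injective g) {C : RowIndex N (m + 1)} {s : ι} (hs : ∀ c ∈ C.1, g c ≠ s) :
    rowForm B (S ∘ g) C (S s) ≠ 0 := by
  rw [rowForm_apply, AlternatingMap.curryLeft_apply_apply]
  have h := hS.det_ne_zero B
    (f := Fin.cons s (g ∘ C.1.orderEmbOfFin (Nat.succ_injective C.2))) (by
      rw [Fin.cons_injective_iff]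
      refine ⟨?_, hg.comp (RelEmbedding.injective _)⟩
      rintro ⟨j, hj⟩
      exact hs _ (orderEmbOfFin_mem _ _ j) hj)
  convert h using 2
  funext i
  refine Fin.cases ?_ (fun j => ?_) i <;> rfl

/-- The alternating bilinear form `(v, w) ↦ det(v, w, r)`. -/
noncomputable def pairForm (B : Module.Basis (Fin (m + 2)) F (Fin (m + 2) → F))
    (r : Fin m → Fin (m + 2) → F) : (Fin (m + 2) → F) →ₗ[F] (Fin (m + 2) → F) →ₗ[F] F :=
  LinearMap.mk₂ F (fun v w => (B.det.curryLeft v).curryLeft w r)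
    (fun v v' w => by rw [map_add, AlternatingMap.curryLeft_add]; rfl)
    (fun a v w => by rw [map_smul, AlternatingMap.curryLeft_smul]; rfl)
    (fun v w w' => by rw [map_add]; rfl)
    (fun a v w => by rw [map_smul]; rfl)

theorem pairForm_apply (B : Module.Basis (Fin (m + 2)) F (Fin (m + 2) → F))
    (r : Fin m → Fin (m + 2) → F) (v w : Fin (m + 2) → F) :
    pairForm B r v w = (B.det.curryLeft v).curryLeft w r := rfl

theorem pairForm_self (B : Module.Basis (Fin (m + 2)) F (Fin (m + 2) → F))
    (r : Fin m → Fin (m + 2) → F) (v : Fin (m + 2) → F) : pairForm B r v v = 0 :=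
  AlternatingMap.map_eq_zero_of_eq B.det _ (i := 0) (j := 1) rfl (by simp)

theorem pairForm_left (B : Module.Basis (Fin (m + 2)) F (Fin (m + 2) → F))
    (r : Fin m → Fin (m + 2) → F) (j : Fin m) : pairForm B r (r j) = 0 := by
  ext w
  exact AlternatingMap.map_eq_zero_of_eq B.det _ (i := 0) (j := j.succ.succ) rfl
    (Fin.succ_ne_zero _).symm

/-- The vectors b_2, b_3, … lie in the radical, so the form descends to a plane, where every
alternating form is a multiple of the determinant. -/
theorem exists_pairForm_eq (B : Module.Basis (Fin (m + 2)) F (Fin (m + 2) → F))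
    (b : Module.Basis (Fin (m + 2)) F (Fin (m + 2) → F)) :
    ∃ (c : F) (x y : (Fin (m + 2) → F) → F), ∀ v w,
      pairForm B (fun j => b j.succ.succ) v w = c * (x v * y w - y v * x w) := by
  set ω := pairForm B (fun j => b j.succ.succ) with hω
  have hl : ∀ v, ω v = b.repr v 0 • ω (b 0) + b.repr v 1 • ω (b 1) := by
    intro v
    conv_lhs => rw [← b.sum_repr v, Fin.sum_univ_succ, Fin.sum_univ_succ]
    rw [map_add, map_add, map_sum, map_smul, map_smul, sum_eq_zero, add_zero]
    · rfl
    · intro j _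
      rw [map_smul, hω, pairForm_left B (fun j => b j.succ.succ) j, smul_zero]
  have hneg : ∀ v w, ω v w = -ω w v := by
    intro v w
    have h1 := pairForm_self B (fun j => b j.succ.succ) (v + w)
    rw [← hω, map_add, map_add, LinearMap.add_apply, LinearMap.add_apply] at h1
    have h2 : ω v v = 0 := pairForm_self _ _ v
    have h3 : ω w w = 0 := pairForm_self _ _ w
    linear_combination h1 - h2 - h3
  refine ⟨ω (b 0) (b 1), fun v => b.repr v 0, fun v => b.repr v 1, fun v w => ?_⟩
  have h1 : ω (b 0) (b 0) = 0 := pairForm_self _ _ _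
  have h2 : ω (b 1) (b 1) = 0 := pairForm_self _ _ _
  rw [hl v, LinearMap.add_apply, LinearMap.smul_apply, LinearMap.smul_apply, hneg (b 0) w,
    hneg (b 1) w, hl w]
  simp only [LinearMap.add_apply, LinearMap.smul_apply, smul_eq_mul]
  rw [h1, h2, hneg (b 1) (b 0)]
  ring

theorem IsArc.exists_pairForm_eq [Fintype ι] {S : ι → Fin (m + 2) → F} (hS : IsArc S)
    (B : Module.Basis (Fin (m + 2)) F (Fin (m + 2) → F)) {a : Fin m → ι}
    (ha : Function.Injective a) :
    ∃ (c : F) (x y : (Fin (m + 2) → F) → F), ∀ v w,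
      pairForm B (S ∘ a) v w = c * (x v * y w - y v * x w) := by
  classical
  obtain ⟨s, hs, t, ht, hst⟩ := one_lt_card.1
    (show 1 < ((univ : Finset ι) \ univ.image a).card by
      have h1 := card_sdiff_add_card_eq_card (subset_univ (univ.image a))
      have h2 := hS.1
      rw [card_image_of_injective _ ha, card_univ, card_univ, Fintype.card_fin] at h1
      omega)
  have hli := hS.linearIndependent_comp le_rfl (f := Fin.cons s (Fin.cons t a)) (by
    rw [Fin.cons_injective_iff, Fin.cons_injective_iff]
    refine ⟨?_, by simpa using ht, ha⟩
    rintro ⟨j, hj⟩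
    revert hj
    refine Fin.cases (fun h => hst h.symm) (fun j hj => ?_) j
    simp only [Fin.cons_succ] at hj
    simp [← hj] at hs)
  have h := ArcMatrix.exists_pairForm_eq B
    (basisOfLinearIndependentOfCardEqFinrank hli (by simp))
  rw [coe_basisOfLinearIndependentOfCardEqFinrank] at h
  exact h

theorem IsArc.pairForm_ne_zero [Fintype ι] {S : ι → Fin (m + 2) → F} (hS : IsArc S)
    (B : Module.Basis (Fin (m + 2)) F (Fin (m + 2) → F)) {a : Fin m → ι}
    (ha : Function.Injective a) {s t : ι} (hs : s ∉ Set.range a) (ht : t ∉ Set.range a)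
    (hst : s ≠ t) : pairForm B (S ∘ a) (S s) (S t) ≠ 0 := by
  have h := hS.det_ne_zero B (f := Fin.cons s (Fin.cons t a)) (by
    rw [Fin.cons_injective_iff, Fin.cons_injective_iff]
    refine ⟨?_, ht, ha⟩
    rintro ⟨j, hj⟩
    revert hj
    exact Fin.cases (fun h => hst h.symm) (fun j hj => hs ⟨j, hj⟩) j)
  convert h using 1
  rw [pairForm_apply]
  change B.det _ = _
  congr 1
  funext i
  refine Fin.cases rfl (fun j => ?_) i
  exact Fin.cases rfl (fun j => rfl) j

theorem exists_rowForm_eq_pairForm (B : Module.Basis (Fin (m + 2)) F (Fin (m + 2) → F))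
    (G : Fin N → Fin (m + 2) → F) {A : Finset (Fin N)} (hA : A.card = m) {e : Fin N}
    {C : RowIndex N (m + 2)} (heA : e ∉ A) (hC : C.1 = insert e A) :
    ∃ ε : F, ε ^ 2 = 1 ∧
      ∀ v, rowForm B G C v = ε * pairForm B (G ∘ A.orderEmbOfFin hA) v (G e) := by
  obtain ⟨ε, hε, h⟩ := exists_sign_of_range_eq (F := F)
    (f := C.1.orderEmbOfFin (Nat.succ_injective C.2)) (g := Fin.cons e (A.orderEmbOfFin hA))
    (RelEmbedding.injective _) (by
      rw [Fin.cons_injective_iff]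
      exact ⟨by rw [range_orderEmbOfFin]; exact heA, RelEmbedding.injective _⟩) (by
      rw [range_orderEmbOfFin, Fin.range_cons, range_orderEmbOfFin, hC, coe_insert]) G
  refine ⟨ε, hε, fun v => ?_⟩
  rw [rowForm_apply, h, pairForm_apply, AlternatingMap.curryLeft_apply_apply]
  change ε * B.det _ = ε * B.det _
  congr 2
  funext i
  exact Fin.cases rfl (fun j => Fin.cases rfl (fun l => rfl) j) i

/-- In coordinates with respect to a standard basis `K` in the arc, `det(v, K \ {i})` is, up to
sign, a fixed multiple of the `i`-th coordinate of `v`. -/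
theorem exists_rowForm_eq_coord (B : Module.Basis (Fin (m + 1)) F (Fin (m + 1) → F))
    {G : Fin N → Fin (m + 1) → F} {f : Fin (m + 1) → Fin N} (hf : Function.Injective f)
    (hG : ∀ i, G (f i) = Pi.single i 1) {i : Fin (m + 1)} {C : RowIndex N (m + 1)}
    (hC : C.1 = (univ.image f).erase (f i)) :
    ∃ ε : F, ε ^ 2 = 1 ∧ ∀ v, rowForm B G C v = ε * B.det (G ∘ f) * v i := by
  obtain ⟨ε, hε, h⟩ := exists_sign_of_range_eq (F := F)
    (f := Fin.cons (f i) (C.1.orderEmbOfFin (Nat.succ_injective C.2))) (g := f)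
    (by
      rw [Fin.cons_injective_iff, range_orderEmbOfFin]
      exact ⟨by simp [hC], RelEmbedding.injective _⟩) hf (by
      rw [Fin.range_cons, range_orderEmbOfFin, hC, ← coe_insert,
        insert_erase (mem_image_of_mem f (mem_univ i))]
      simp) G
  have hi : rowForm B G C (G (f i)) = ε * B.det (G ∘ f) := by
    rw [← h, rowForm_apply, AlternatingMap.curryLeft_apply_apply]
    congr 1
    funext j
    exact Fin.cases rfl (fun j => rfl) j
  refine ⟨ε, hε, fun v => ?_⟩
  conv_lhs => rw [← (Pi.basisFun F (Fin (m + 1))).sum_repr v, map_sum]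
  rw [sum_eq_single i]
  · rw [map_smul, Pi.basisFun_apply, Pi.basisFun_repr, ← hG, hi, smul_eq_mul, mul_comm]
  · intro j _ hj
    rw [map_smul, Pi.basisFun_apply, ← hG, rowForm_apply_of_mem, smul_zero]
    rw [hC]
    exact mem_erase.2 ⟨fun h => hj (hf h), mem_image_of_mem f (mem_univ j)⟩
  · simp

end RowForm

end ArcMatrix

namespace ArcMatrix

open Finset

/-! ### The initial rows and final subsets in colex order. -/

section Colex

variable {N k : ℕ}

/-- The rows `K \ {i}`, with `K` the set of the first `k` positions. -/
def initialErase (h : k ≤ N) (i : Fin k) : RowIndex N k :=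
  ⟨(univ.image (Fin.castLE h)).erase (Fin.castLE h i), by
    rw [card_erase_add_one (mem_image_of_mem _ (mem_univ i)),
      card_image_of_injective _ (Fin.castLE_injective h), card_univ, Fintype.card_fin]⟩

theorem initialErase_injective (h : k ≤ N) : Function.Injective (initialErase h) := by
  intro i j hij
  by_contra hne
  have h1 : Fin.castLE h i ∉ (initialErase h i).1 := notMem_erase _ _
  rw [hij] at h1
  exact h1 (mem_erase.2 ⟨fun h' => hne (Fin.castLE_injective h h'),
    mem_image_of_mem _ (mem_univ i)⟩)

theorem val_lt_of_mem_initialErase {h : k ≤ N} {i : Fin k} {c : Fin N}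
    (hc : c ∈ (initialErase h i).1) : c.val < k := by
  obtain ⟨j, -, rfl⟩ := mem_image.1 (mem_of_mem_erase hc)
  exact j.2

theorem exists_initialErase_eq (h : k ≤ N) {C : RowIndex N k} (hC : ∀ c ∈ C.1, c.val < k) :
    ∃ i, initialErase h i = C := by
  have hsub : C.1 ⊆ univ.image (Fin.castLE h) := fun c hc =>
    mem_image.2 ⟨⟨c.val, hC c hc⟩, mem_univ _, rfl⟩
  have hcard := card_sdiff_add_card_eq_card hsub
  rw [card_image_of_injective _ (Fin.castLE_injective h), card_univ, Fintype.card_fin] at hcard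
  obtain ⟨x, hx⟩ := card_eq_one.1 (show (univ.image (Fin.castLE h) \ C.1).card = 1 by
    have := C.2; omega)
  have hxm : x ∈ univ.image (Fin.castLE h) \ C.1 := by rw [hx]; exact mem_singleton_self x
  obtain ⟨i, -, hi⟩ := mem_image.1 (mem_sdiff.1 hxm).1
  refine ⟨i, Subtype.ext ?_⟩
  change (univ.image (Fin.castLE h)).erase (Fin.castLE h i) = C.1
  rw [hi, ← sdiff_singleton_eq_erase, ← hx, Finset.sdiff_sdiff_eq_self hsub]

/-- Subsets of an initial segment of positions come first in colex order, and exactly k of them have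
size k - 1. -/
theorem colexPosition_le_iff (h : k ≤ N) (C : RowIndex N k) :
    colexPosition C ≤ k ↔ ∀ c ∈ C.1, c.val < k := by
  have hk : 0 < k := by have := C.2; omega
  have hcard : (univ.image (initialErase h)).card = k := by
    rw [card_image_of_injective _ (initialErase_injective h), card_univ, Fintype.card_fin]
  constructor
  · intro hpos
    by_contra! hc
    obtain ⟨c, hcC, hc⟩ := hc
    have hnot : C ∉ univ.image (initialErase h) := fun hmem => by
      obtain ⟨i, -, rfl⟩ := mem_image.1 hmem
      exact absurd (val_lt_of_mem_initialErase hcC) (by omega)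
    have hsub : insert C (univ.image (initialErase h)) ⊆
        univ.filter fun C' : RowIndex N k => toColex C'.1 ≤ toColex C.1 := by
      intro C' hC'
      refine mem_filter.2 ⟨mem_univ _, ?_⟩
      obtain rfl | hC' := mem_insert.1 hC'
      · exact le_rfl
      obtain ⟨i, -, rfl⟩ := mem_image.1 hC'
      rw [Colex.toColex_le_toColex]
      intro a ha _
      have := val_lt_of_mem_initialErase ha
      refine ⟨c, hcC, fun h' => ?_, Fin.le_def.2 (by omega)⟩
      have := val_lt_of_mem_initialErase h'
      omega
    have h1 := card_le_card hsub
    rw [card_insert_of_notMem hnot, hcard] at h1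
    unfold colexPosition at hpos
    omega
  · intro hC
    refine (card_le_card fun C' hC' => ?_).trans_eq hcard
    have h1 := Colex.forall_le_mono (a := (⟨k - 1, by omega⟩ : Fin N)) (mem_filter.1 hC').2
      fun b hb => Fin.le_def.2 (by have := hC b hb; simp only; omega)
    obtain ⟨i, hi⟩ := exists_initialErase_eq h (C := C') fun c hc => by
      have := Fin.le_def.1 (h1 c hc)
      simp only at this
      omega
    exact mem_image.2 ⟨i, mem_univ _, hi⟩

theorem sum_mul_firstOnes {F : Type*} [Field F] (h : k ≤ N) (y : RowIndex N k → F) :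
    y ⬝ᵥ firstOnes F N k = ∑ i, y (initialErase h i) := by
  have h1 : ∀ C, firstOnes F N k C = if C ∈ univ.image (initialErase h) then 1 else 0 := by
    intro C
    unfold firstOnes
    refine if_congr ?_ rfl rfl
    rw [colexPosition_le_iff h]
    constructor
    · intro hC
      obtain ⟨i, hi⟩ := exists_initialErase_eq h hC
      exact mem_image.2 ⟨i, mem_univ _, hi⟩
    · intro hC
      obtain ⟨i, -, rfl⟩ := mem_image.1 hC
      exact fun c hc => val_lt_of_mem_initialErase hc
  simp only [dotProduct, h1, mul_ite, mul_one, mul_zero]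
  rw [← sum_filter, filter_mem_eq_inter, univ_inter,
    sum_image fun i _ j _ hij => initialErase_injective h hij]

theorem lastSubset_subset {X : Finset (Fin N)} {n : ℕ} (hn : n ≤ X.card) :
    lastSubset X n ⊆ X := by
  obtain ⟨U, hU, h⟩ := exists_mem_eq_sup (X.powersetCard n) (powersetCard_nonempty.2 hn) toColex
  rw [lastSubset, h, ofColex_toColex]
  exact (mem_powersetCard.1 hU).1

theorem card_filter_le_val {l n : ℕ} (hN : N = l + n) :
    (univ.filter fun i : Fin N => l ≤ i.val).card = n := by
  subst hN
  have h1 : (univ.filter fun i : Fin (l + n) => l ≤ i.val) = univ.map (Fin.natAddEmb l) := by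
    ext i
    simp only [mem_filter, mem_univ, true_and, mem_map, Fin.natAddEmb_apply]
    exact ⟨fun h => ⟨⟨i.val - l, by omega⟩, Fin.ext (by simp; omega)⟩,
      fun ⟨j, hj⟩ => by rw [← hj]; simp⟩
  rw [h1, card_map, card_univ, Fintype.card_fin]

theorem lastSubset_eq_filter {X : Finset (Fin N)} {l n : ℕ} (hN : N = l + n)
    (hX : univ.filter (fun i : Fin N => l ≤ i.val) ⊆ X) :
    lastSubset X n = univ.filter fun i : Fin N => l ≤ i.val := by
  have hcard := card_filter_le_val hN
  have hsup : (X.powersetCard n).sup toColex =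
      toColex (univ.filter fun i : Fin N => l ≤ i.val) := by
    refine le_antisymm (Finset.sup_le fun U hU => ?_)
      (le_sup (f := toColex) (mem_powersetCard.2 ⟨hX, hcard⟩))
    rw [Colex.toColex_le_toColex]
    intro a ha ha'
    obtain ⟨b, hb, hbU⟩ := not_subset.1 fun hsub => ha'
      (eq_of_subset_of_card_le hsub ((mem_powersetCard.1 hU).2.trans hcard.symm).le ▸ ha)
    refine ⟨b, hb, hbU, Fin.le_def.2 ?_⟩
    simp only [mem_filter, mem_univ, true_and] at hb ha'
    omega
  rw [lastSubset, hsup, ofColex_toColex]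

end Colex

end ArcMatrix

namespace ArcMatrix

open Finset

/-! ### The left kernel vector and its pairing with the initial rows. -/

section LeftKernel

variable {F : Type*} [Field F] {m N : ℕ} {ι : Type*} [Fintype ι] [DecidableEq ι]

/-- The coefficients of a linear relation between the rows of `M_G^{↑n}`, for `G` a part of an arc
of size `q + 1`. -/
noncomputable def rowWeight (B : Module.Basis (Fin (m + 1)) F (Fin (m + 1) → F))
    (S : ι → Fin (m + 1) → F) (g : Fin N → ι) (C : RowIndex N (m + 1)) : F :=
  (∏ y ∈ C.1ᶜ, rowForm B (S ∘ g) C (S (g y)))⁻¹ *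
    (∏ s ∈ univ \ C.1.image g, rowForm B (S ∘ g) C (S s))⁻¹

theorem rowWeight_mul_prod {B : Module.Basis (Fin (m + 1)) F (Fin (m + 1) → F)}
    {S : ι → Fin (m + 1) → F} (hS : IsArc S) {g : Fin N → ι} (hg : Function.Injective g)
    {C : RowIndex N (m + 1)} {U : Finset (Fin N)} (hU : U ⊆ C.1ᶜ) :
    rowWeight B S g C * ∏ u ∈ U, detCons B (S ∘ g) u C =
      (∏ y ∈ C.1ᶜ \ U, rowForm B (S ∘ g) C (S (g y)))⁻¹ *
        (∏ s ∈ univ \ C.1.image g, rowForm B (S ∘ g) C (S s))⁻¹ := by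
  have h1 : ∏ u ∈ U, detCons B (S ∘ g) u C = ∏ u ∈ U, rowForm B (S ∘ g) C (S (g u)) :=
    prod_congr rfl fun u _ => detCons_eq_rowForm B (S ∘ g) u C
  have h0 : ∏ u ∈ U, rowForm B (S ∘ g) C (S (g u)) ≠ 0 := prod_ne_zero_iff.2 fun u hu =>
    hS.rowForm_ne_zero B hg fun c hc h => mem_compl.1 (hU hu) (hg h ▸ hc)
  rw [h1, rowWeight, ← prod_sdiff hU, mul_inv]
  field_simp

/-- There are q + 1 factors in all and ε^(q+1) = ε². Hence signs from reordering determinants, which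
vary with the row, disappear. -/
theorem sign_scaled_prod_inv_mul_prod_inv [Fintype F] {α β : Type*} {a : Finset α} {b : Finset β}
    (hab : a.card + b.card = Fintype.card F + 1) (ε : F) (f : α → F) (h : β → F) :
    (∏ y ∈ a, ε * f y)⁻¹ * (∏ s ∈ b, ε * h s)⁻¹ =
      (ε ^ 2)⁻¹ * ((∏ y ∈ a, f y)⁻¹ * (∏ s ∈ b, h s)⁻¹) := by
  rw [prod_mul_distrib, prod_mul_distrib, prod_const, prod_const, ← pow_card_add_one, ← hab,
    pow_add]
  simp only [mul_inv]
  ring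

/-- In a column (U, A) the entry cancels the factors of the weight indexed by U, leaving the planar
identity for E = G \ (A ∪ U) and I = S \ A. For m = 0 the set I would fill the projective line and
have no affine chart. -/
theorem rowWeight_vecMul_matM [Fintype F] (hι : Fintype.card ι = Fintype.card F + 1) (hm : 1 ≤ m)
    (B : Module.Basis (Fin (m + 2)) F (Fin (m + 2) → F)) {S : ι → Fin (m + 2) → F} (hS : IsArc S)
    {g : Fin N → ι} (hg : Function.Injective g) {n : ℕ} (hN : N = m + 2 + m + n) :
    Matrix.vecMul (rowWeight B S g) (matM B (S ∘ g) n) = 0 := by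
  funext ⟨⟨U, A⟩, hU, hA, hAU⟩
  dsimp only at hU hA hAU
  replace hA : A.card = m := by omega
  set E : Finset (Fin N) := (A ∪ U)ᶜ with hE
  have hEcard : E.card = m + 2 := by
    rw [hE, card_compl, card_union_of_disjoint hAU, hU, hA, Fintype.card_fin]; omega
  have hEA : ∀ e ∈ E, e ∉ A := fun e he h => mem_compl.1 he (mem_union_left U h)
  have hEU : ∀ e ∈ E, e ∉ U := fun e he h => mem_compl.1 he (mem_union_right A h)
  set a : Fin m → Fin N := ⇑(A.orderEmbOfFin hA) with ha
  have hainj : Function.Injective (g ∘ a) := hg.comp (RelEmbedding.injective _)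
  have har : ∀ s, s ∈ A.image g ↔ s ∈ Set.range (g ∘ a) := fun s => by
    rw [Set.range_comp, ha, range_orderEmbOfFin, ← coe_image, mem_coe]
  set I : Finset ι := univ \ A.image g with hI
  have hIcard : I.card + m = Fintype.card F + 1 := by
    have h := card_sdiff_add_card_eq_card (subset_univ (A.image g))
    rwa [card_image_of_injective _ hg, hA, card_univ, hι] at h
  have hIa : ∀ s ∈ I, s ∉ Set.range (g ∘ a) := fun s hs h =>
    (mem_sdiff.1 hs).2 ((har s).2 h)
  have hgE : E.image g ⊆ I := by
    intro s hs
    obtain ⟨e, he, rfl⟩ := mem_image.1 hs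
    refine mem_sdiff.2 ⟨mem_univ _, fun h => ?_⟩
    obtain ⟨e', he', h'⟩ := mem_image.1 h
    exact hEA e he (hg h' ▸ he')
  obtain ⟨c, x, y, hxy⟩ := hS.exists_pairForm_eq B hainj
  -- The coordinates are exchanged because `e` is the second argument of `pairForm`.
  have key := sum_inv_prod_det_eq_zero (F := F) hgE
    (by rw [card_image_of_injective _ hg]; omega)
    (by rw [card_image_of_injective _ hg]; omega) (c := c) (x := fun s => y (S s))
    (y := fun s => x (S s)) (d := fun e s => pairForm B (S ∘ (g ∘ a)) (S s) (S e))
    (fun e _ s _ => by rw [hxy]; ring)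
    (fun e he s hs hne => hS.pairForm_ne_zero B hainj (hIa s hs) (hIa e he) hne.symm)
  rw [sum_image fun _ _ _ _ h => hg h] at key
  simp only [Matrix.vecMul, dotProduct, matM, Matrix.of_apply, mul_ite, mul_zero, Pi.zero_apply]
  rw [← sum_filter, ← key]
  symm
  have hins : ∀ e ∈ E, (insert e A).card + 1 = m + 2 := fun e he => by
    rw [card_insert_of_notMem (hEA e he), hA]
  refine sum_bij (fun e he => (⟨insert e A, hins e he⟩ : RowIndex N (m + 2))) ?_ ?_ ?_ ?_
  · intro e he
    refine mem_filter.2 ⟨mem_univ _, subset_insert _ _, ?_⟩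
    rw [disjoint_insert_left]
    exact ⟨hEU e he, hAU⟩
  · intro e he e' he' h
    have h1 : insert e A = insert e' A := congrArg Subtype.val h
    have h2 : e ∈ insert e' A := h1 ▸ mem_insert_self e A
    exact (mem_insert.1 h2).resolve_right (hEA e he)
  · intro C hC
    obtain ⟨-, hAC, hCU⟩ := mem_filter.1 hC
    have h1 := card_sdiff_add_card_eq_card hAC
    obtain ⟨e, he⟩ := card_eq_one.1 (show (C.1 \ A).card = 1 by have := C.2; omega)
    have heC : e ∈ C.1 \ A := he ▸ mem_singleton_self e
    rw [mem_sdiff] at heC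
    refine ⟨e, ?_, Subtype.ext ?_⟩
    · rw [hE, mem_compl, mem_union, not_or]
      exact ⟨heC.2, disjoint_left.1 hCU heC.1⟩
    · change insert e A = C.1
      rw [insert_eq, ← he, sdiff_union_of_subset hAC]
  · intro e he
    have hUC : U ⊆ (insert e A)ᶜ := by
      intro u hu
      rw [mem_compl, mem_insert, not_or]
      exact ⟨fun h => hEU e he (h ▸ hu), disjoint_right.1 hAU hu⟩
    have hset : (insert e A)ᶜ \ U = E.erase e := by
      ext u
      simp only [hE, mem_sdiff, mem_compl, mem_insert, mem_erase, mem_union]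
      tauto
    have hset' : univ \ (insert e A).image g = I.erase (g e) := by
      ext s
      simp only [hI, mem_sdiff, mem_univ, true_and, image_insert, mem_insert, mem_erase]
      tauto
    obtain ⟨ε, hε, hform⟩ := exists_rowForm_eq_pairForm B (S ∘ g) hA
      (C := ⟨insert e A, hins e he⟩) (hEA e he) rfl
    rw [rowWeight_mul_prod hS hg hUC]
    simp only [hset, hset', hform]
    rw [sign_scaled_prod_inv_mul_prod_inv, hε, inv_one, one_mul, ← image_erase hg,
      prod_image fun _ _ _ _ h => hg h]
    · rfl
    · rw [card_erase_of_mem he, card_erase_of_mem (hgE (mem_image_of_mem g he))]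
      have := card_le_card hgE
      rw [card_image_of_injective _ hg] at this
      omega

theorem dotProduct_eq_zero_of_mem_span {α β : Type*} [Fintype α] {A : Matrix α β F} {y v : α → F}
    (hy : Matrix.vecMul y A = 0) (hv : v ∈ Submodule.span F (Set.range A.col)) :
    y ⬝ᵥ v = 0 := by
  induction hv using Submodule.span_induction with
  | mem x hx => obtain ⟨j, rfl⟩ := hx; exact congrFun hy j
  | zero => exact dotProduct_zero y
  | add x z _ _ hx hz => rw [dotProduct_add, hx, hz, add_zero]
  | smul a x _ hx => rw [dotProduct_smul, hx, smul_zero]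

/-- Multiplying the weights by the inverse diagonal of `matJ` moves the kernel vector from `matM` to
`matH`, where it is orthogonal to the column space. -/
theorem sum_initialErase_eq_zero [Fintype F] (hι : Fintype.card ι = Fintype.card F + 1)
    (hm : 1 ≤ m) (B : Module.Basis (Fin (m + 2)) F (Fin (m + 2) → F)) {S : ι → Fin (m + 2) → F}
    (hS : IsArc S) {g : Fin N → ι} (hg : Function.Injective g) {n : ℕ} (hN : N = m + 2 + m + n)
    (hk : m + 2 ≤ N)
    (h : firstOnes F N (m + 2) ∈ Submodule.span F (Set.range (matH B (S ∘ g) n).col)) :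
    ∑ i, rowWeight B S g (initialErase hk i) *
      ∏ u ∈ lastSubset (initialErase hk i).1ᶜ n, detCons B (S ∘ g) u (initialErase hk i) = 0 := by
  rw [← sum_mul_firstOnes hk fun C => rowWeight B S g C *
    ∏ u ∈ lastSubset C.1ᶜ n, detCons B (S ∘ g) u C]
  refine dotProduct_eq_zero_of_mem_span ?_ h
  rw [matH, ← Matrix.vecMul_vecMul, ← rowWeight_vecMul_matM hι hm B hS hg hN]
  congr 1
  funext C
  rw [matJ, Matrix.vecMul_diagonal, prod_inv_distrib, mul_assoc, mul_inv_cancel₀, mul_one]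
  refine prod_ne_zero_iff.2 fun u hu => ?_
  rw [detCons_eq_rowForm]
  have hn : n ≤ (C.1ᶜ).card := by
    rw [card_compl, Fintype.card_fin]
    have := C.2
    omega
  exact hS.rowForm_ne_zero B hg fun c hc h =>
    mem_compl.1 (lastSubset_subset hn hu) (hg h ▸ hc)

theorem sum_prod_inv_coord_eq_zero [Fintype F] (hι : Fintype.card ι = Fintype.card F + 1)
    (hm : 1 ≤ m) (B : Module.Basis (Fin (m + 2)) F (Fin (m + 2) → F)) {S : ι → Fin (m + 2) → F}
    (hS : IsArc S) {g : Fin N → ι} (hg : Function.Injective g) {n : ℕ} (hN : N = m + 2 + m + n)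
    (hk : m + 2 ≤ N) (hbasis : ∀ i, S (g (Fin.castLE hk i)) = Pi.single i 1)
    (h : firstOnes F N (m + 2) ∈ Submodule.span F (Set.range (matH B (S ∘ g) n).col)) :
    ∑ i, (∏ z ∈ (univ.filter fun u : Fin N => m + 2 ≤ u.val ∧ u.val < m + 2 + m),
        (S (g z) i)⁻¹) *
      ∏ s ∈ univ \ univ.image (g ∘ Fin.castLE hk), (S s i)⁻¹ = 0 := by
  set Z : Finset (Fin N) := univ.filter fun u : Fin N => m + 2 ≤ u.val ∧ u.val < m + 2 + m with hZ
  set f := Fin.castLE hk with hf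
  have hfi : Function.Injective f := Fin.castLE_injective hk
  set δ : F := B.det ((S ∘ g) ∘ f) with hδ
  have hδ0 : δ ≠ 0 := hS.det_ne_zero B (hg.comp hfi)
  have key := sum_initialErase_eq_zero hι hm B hS hg hN hk h
  have hsum : ∀ i, rowWeight B S g (initialErase hk i) *
      ∏ u ∈ lastSubset (initialErase hk i).1ᶜ n, detCons B (S ∘ g) u (initialErase hk i) =
      (δ ^ 2)⁻¹ * ((∏ z ∈ Z, (S (g z) i)⁻¹) * ∏ s ∈ univ \ univ.image (g ∘ f), (S s i)⁻¹) := by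
    intro i
    have hval : ∀ c : Fin N, c ∈ (initialErase hk i).1 ↔ c.val < m + 2 ∧ c ≠ f i := by
      intro c
      rw [initialErase, mem_erase, and_comm]
      refine and_congr_left fun _ => ?_
      exact ⟨fun h => by obtain ⟨j, -, rfl⟩ := mem_image.1 h; exact j.2,
        fun h => mem_image.2 ⟨⟨c.val, h⟩, mem_univ _, rfl⟩⟩
    have hfilter : univ.filter (fun u : Fin N => m + 2 + m ≤ u.val) ⊆ (initialErase hk i).1ᶜ := by
      intro u hu
      rw [mem_compl, hval]
      have := (mem_filter.1 hu).2
      omega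
    -- All initial rows share the same L_C, the last n positions; removing it from the complement of
    -- C leaves `f i` and the middle block `Z`.
    have hlast := lastSubset_eq_filter hN hfilter
    have hfi_val : (f i).val = i.val := rfl
    have hi2 := i.2
    have hset : (initialErase hk i).1ᶜ \ univ.filter (fun u : Fin N => m + 2 + m ≤ u.val) =
        insert (f i) Z := by
      ext u
      rw [mem_sdiff, mem_compl, hval, mem_insert, hZ, mem_filter, mem_filter]
      simp only [mem_univ, true_and, ne_eq, Fin.ext_iff]
      omega
    have hset' : univ \ (initialErase hk i).1.image g =
        insert (g (f i)) (univ \ univ.image (g ∘ f)) := by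
      have h1 : (initialErase hk i).1.image g = (univ.image (g ∘ f)).erase (g (f i)) := by
        rw [← image_image, ← image_erase hg]; rfl
      rw [h1, sdiff_erase (mem_univ _)]
    have hfZ : f i ∉ Z := by
      rw [hZ, mem_filter]; omega
    have hfS : g (f i) ∉ univ \ univ.image (g ∘ f) := fun h =>
      (mem_sdiff.1 h).2 (mem_image_of_mem (g ∘ f) (mem_univ i))
    obtain ⟨ε, hε, hform⟩ := exists_rowForm_eq_coord B (G := S ∘ g) hfi hbasis (i := i)
      (C := initialErase hk i) rfl
    rw [hlast, rowWeight_mul_prod hS hg hfilter, hset, hset']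
    simp only [hform]
    -- The basis vector `f i` contributes coordinate 1 to both products, and the scalar εδ
    -- contributes δ², the same for every i.
    rw [sign_scaled_prod_inv_mul_prod_inv, prod_insert hfZ, prod_insert hfS, hbasis,
      Pi.single_eq_same, one_mul, one_mul, mul_pow, hε, one_mul, prod_inv_distrib,
      prod_inv_distrib]
    rw [card_insert_of_notMem hfS, card_sdiff_of_subset (subset_univ _),
      card_image_of_injective _ (hg.comp hfi), card_univ, card_univ, Fintype.card_fin, hι,
      ← hset, card_sdiff_of_subset hfilter, card_filter_le_val hN]
    have h2 := hS.1
    rw [card_compl, Fintype.card_fin]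
    have := (initialErase hk i).2
    omega
  rw [sum_congr rfl fun i _ => hsum i, ← mul_sum] at key
  exact (mul_eq_zero.1 key).resolve_left (inv_ne_zero (pow_ne_zero 2 hδ0))

end LeftKernel

end ArcMatrix

namespace ArcMatrix

open Finset

/-! ### Choice of the subarcs and conclusion. -/

section Main

/-- A family `κ` and a set `Z` outside its range extend to an injective family which runs through
`κ` first and through `Z` next. -/
theorem exists_injective_extension {ι : Type*} [Fintype ι] [DecidableEq ι] {k m n : ℕ}
    {κ : Fin k → ι} (hκ : Function.Injective κ) {Z : Finset ι} (hZ : ∀ z ∈ Z, z ∉ Set.range κ)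
    (hZm : Z.card = m) (hcard : k + m + n ≤ Fintype.card ι) (hk : k ≤ k + m + n) :
    ∃ g : Fin (k + m + n) → ι, Function.Injective g ∧ g ∘ Fin.castLE hk = κ ∧
      (univ.filter fun u : Fin (k + m + n) => k ≤ u.val ∧ u.val < k + m).image g = Z := by
  obtain ⟨R, hR, hRn⟩ := exists_subset_card_eq (s := univ \ (univ.image κ ∪ Z)) (n := n) (by
    have h1 := card_sdiff_add_card_eq_card (subset_univ (univ.image κ ∪ Z))
    have h2 := card_union_le (univ.image κ) Z
    rw [card_image_of_injective _ hκ, card_univ, Fintype.card_fin, hZm] at h2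
    rw [card_univ] at h1
    omega)
  let eZ := (Z.equivFinOfCardEq hZm).symm
  let eR := (R.equivFinOfCardEq hRn).symm
  let ζ : Fin m → ι := fun j => eZ j
  let ρ : Fin n → ι := fun j => eR j
  have hζ : Function.Injective ζ := Subtype.val_injective.comp eZ.injective
  have hρ : Function.Injective ρ := Subtype.val_injective.comp eR.injective
  have hρR : ∀ j, (∀ i, κ i ≠ ρ j) ∧ ρ j ∉ Z := fun j => by
    have h := hR (eR j).2
    rw [mem_sdiff, mem_union, not_or] at h
    exact ⟨fun i hi => h.2.1 (mem_image.2 ⟨i, mem_univ i, hi⟩), h.2.2⟩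
  have h1 : Function.Injective (Fin.append κ ζ) :=
    Fin.append_injective_iff.2 ⟨hκ, hζ, fun i j h => hZ _ (eZ j).2 ⟨i, h⟩⟩
  refine ⟨Fin.append (Fin.append κ ζ) ρ, Fin.append_injective_iff.2 ⟨h1, hρ, fun i j => ?_⟩, ?_, ?_⟩
  · refine Fin.addCases (fun i => ?_) (fun i => ?_) i
    · rw [Fin.append_left]; exact (hρR j).1 i
    · rw [Fin.append_right]; exact fun h => (hρR j).2 (h ▸ (eZ i).2)
  · funext i
    change Fin.append (Fin.append κ ζ) ρ (Fin.castAdd n (Fin.castAdd m i)) = κ i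
    rw [Fin.append_left, Fin.append_left]
  · have hval : ∀ j : Fin m, Fin.append (Fin.append κ ζ) ρ (Fin.castAdd n (Fin.natAdd k j)) = ζ j :=
      fun j => by rw [Fin.append_left, Fin.append_right]
    ext x
    constructor
    · intro hx
      obtain ⟨u, hu, rfl⟩ := mem_image.1 hx
      have hu := (mem_filter.1 hu).2
      have h2 : u = Fin.castAdd n (Fin.natAdd k ⟨u.val - k, by omega⟩) := Fin.ext (by simp; omega)
      rw [h2, hval]
      exact (eZ _).2
    · intro hx
      refine mem_image.2 ⟨Fin.castAdd n (Fin.natAdd k (eZ.symm ⟨x, hx⟩)),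
        mem_filter.2 ⟨mem_univ _, by simp⟩, ?_⟩
      rw [hval]
      simp [ζ]

variable {F : Type*} [Field F] {ι : Type*} [Fintype ι]

theorem IsArc.exists_mulVec_eq_single {k : ℕ} {S : ι → Fin k → F} (hS : IsArc S) {κ : Fin k → ι}
    (hκ : Function.Injective κ) :
    ∃ P : GL (Fin k) F, ∀ i, (P : Matrix (Fin k) (Fin k) F).mulVec (S (κ i)) = Pi.single i 1 := by
  let A : Matrix (Fin k) (Fin k) F := (Matrix.of (S ∘ κ)).transpose
  have hA : IsUnit A :=
    Matrix.linearIndependent_cols_iff_isUnit.1 (hS.linearIndependent_comp le_rfl hκ)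
  obtain ⟨P, hP⟩ := hA
  refine ⟨P⁻¹, fun i => ?_⟩
  have h1 : S (κ i) = (P : Matrix (Fin k) (Fin k) F).mulVec (Pi.single i 1) := by
    rw [hP, Matrix.mulVec_single_one]; rfl
  rw [h1, Matrix.mulVec_mulVec, Units.inv_mul, Matrix.one_mulVec]

theorem linearlyEquivalent_normalRationalCurve_one [Fintype F]
    (hι : Fintype.card ι = Fintype.card F + 1) {S : ι → Fin 1 → F} (hS : IsArc S) :
    LinearlyEquivalent S (normalRationalCurve F 1) := by
  have hne : ∀ s, S s 0 ≠ 0 := fun s h0 => by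
    have h := (hS.linearIndependent_comp le_rfl (f := fun _ : Fin 1 => s)
      (Function.injective_of_subsingleton _)).ne_zero 0
    exact h (funext fun i => by rw [Fin.fin_one_eq_zero i]; exact h0)
  obtain ⟨σ⟩ : Nonempty (Option F ≃ ι) := ⟨Fintype.equivOfCardEq (by rw [hι, Fintype.card_option])⟩
  refine ⟨1, σ, fun j => (Units.mk0 _ (hne (σ j)))⁻¹, fun j => funext fun i => ?_⟩
  rw [Fin.fin_one_eq_zero i]
  rcases j with _ | t <;> simp [normalRationalCurve, hne]

/-- The hypothesis covers every ordering of every subarc, so K can be placed first and any chosen Z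
next, with n further members of S to fill up. -/
theorem linearlyEquivalent_normalRationalCurve [Fintype F] [DecidableEq ι] {m n : ℕ}
    (hn : n + 2 * (m + 2) ≤ Fintype.card F)
    (B : Module.Basis (Fin (m + 2)) F (Fin (m + 2) → F))
    (hH : ∀ G : Fin (m + 2 + m + n) → Fin (m + 2) → F, IsArc G →
      firstOnes F (m + 2 + m + n) (m + 2) ∈ Submodule.span F (Set.range (matH B G n).col))
    (hι : Fintype.card ι = Fintype.card F + 1) {S : ι → Fin (m + 2) → F} (hS : IsArc S) :
    LinearlyEquivalent S (normalRationalCurve F (m + 2)) := by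
  obtain ⟨κ⟩ : Nonempty (Fin (m + 2) ↪ ι) :=
    Function.Embedding.nonempty_of_card_le (by rw [Fintype.card_fin]; exact hS.1)
  obtain ⟨P, hP⟩ := hS.exists_mulVec_eq_single κ.injective
  have hS' := hS.mulVec P
  refine LinearlyEquivalent.of_mulVec P ?_
  set T : ι → Fin (m + 2) → F := fun i => (P : Matrix (Fin (m + 2)) (Fin (m + 2)) F).mulVec (S i)
  refine linearlyEquivalent_of_form_vanishes hS' (by omega) (by omega) hι κ.injective hP
    (γ := fun i => ∏ s ∈ univ \ univ.image κ, (T s i)⁻¹) (fun i => ?_) ?_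
  · refine prod_ne_zero_iff.2 fun s hs => inv_ne_zero (hS'.coord_ne_zero κ.injective hP ?_ i)
    simpa using hs
  · intro hk Z hZ hZm
    have hkN : m + 2 ≤ m + 2 + m + n := by omega
    obtain ⟨g, hg, hgκ, hgZ⟩ := exists_injective_extension (n := n) κ.injective hZ
      (m := m) (by omega) (by omega) hkN
    have h := sum_prod_inv_coord_eq_zero hι (by omega) B hS' hg rfl hkN
      (fun i => by rw [← hP i]; exact congrArg T (congrFun hgκ i))
      (hH _ (hS'.comp (by rw [Fintype.card_fin]; exact hkN) hg))
    rw [hgκ] at h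
    rw [← h, ← hgZ]
    refine sum_congr rfl fun i _ => ?_
    rw [prod_image fun _ _ _ _ h => hg h]

end Main

end ArcMatrix

theorem mainTheorem4 {F : Type*} [Field F] [Fintype F] (k n : ℕ) (hk : 1 ≤ k)
    (hn : n + 2 * k ≤ Fintype.card F)
    (B : Module.Basis (Fin k) F (Fin k → F))
    (hH : ∀ G : Fin (2 * k - 2 + n) → Fin k → F, ArcMatrix.IsArc G →
      ArcMatrix.firstOnes F (2 * k - 2 + n) k ∈
        Submodule.span F (Set.range (ArcMatrix.matH B G n).col)) :
    ArcMatrix.IsArc (ArcMatrix.normalRationalCurve F k) ∧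
      Fintype.card (Option F) = Fintype.card F + 1 ∧
      ∀ S : Fin (Fintype.card F + 1) → Fin k → F, ArcMatrix.IsArc S →
        ArcMatrix.LinearlyEquivalent S (ArcMatrix.normalRationalCurve F k) := by
  refine ⟨ArcMatrix.isArc_normalRationalCurve (by omega), Fintype.card_option, fun S hS => ?_⟩
  obtain rfl | ⟨m, rfl⟩ : k = 1 ∨ ∃ m, k = m + 2 := by
    obtain rfl | h : k = 1 ∨ 2 ≤ k := by omega
    · exact Or.inl rfl
    · exact Or.inr ⟨k - 2, by omega⟩
  -- In dimension one an arc is a family of nonzero scalars, and rescaling columns suffices.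
  · exact ArcMatrix.linearlyEquivalent_normalRationalCurve_one (Fintype.card_fin _) hS
  · rw [show 2 * (m + 2) - 2 + n = m + 2 + m + n by omega] at hH
    exact ArcMatrix.linearlyEquivalent_normalRationalCurve hn B hH (Fintype.card_fin _) hS
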